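/- Let $H$ be a complex Hilbert space with orthonormal basis $\{e_n\}_{n\ge 0}$, let $\alpha=(\alpha_n)_{n\ge 0}$ be a bounded sequence of positive real numbers, and let $W_\alpha$ be the bounded weighted shift on $H$ given by $W_\alpha e_n=\alpha_n e_{n+1}$ for all $n \ge 0$. Its moments are $\gamma_0=1$ and $\gamma_n=\alpha_0^2\alpha_1^2\cdots\alpha_{n-1}^2$ for $n\ge 1$. Suppose that $a,b,c>0$, $p>0$ and $-p<r<q$ are real numbers such that the positive three-atom measure $\mu=a\delta_{-p}+b\delta_r+c\delta_q$ represents these moments, i.e. $$\gamma_n=\int_{\mathbb R}t^n\,d\mu(t)=a(-p)^n+b\,r^n+c\,q^n\qquad\text{for all } n\ge 0.$$ Let $\tilde W_\alpha=|W_\alpha|^{1/2}\,U\,|W_\alpha|^{1/2}$ be the Aluthge transform of $W_\alpha$, where $W_\alpha=U|W_\alpha|$ is the polar decomposition, that is, $|W_\alpha|=(W_\alpha^*W_\alpha)^{1/2}$ and $U$ is the unique partial isometry satisfying this factorization with $\ker U=\ker W_\alpha$ and $\ker U^*=\ker W_\alpha^*$. Then $\tilde W_\alpha$ is subnormal (i.e.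 it is the restriction of a normal operator on a Hilbert space containing $H$ to the invariant subspace $H$) if and only if $r=0$ and $p=q$. -/

import Mathlib

open MeasureTheory

universe u

noncomputable section

section Operators

variable {H : Type u} [NormedAddCommGroup H] [InnerProductSpace ℂ H] [CompleteSpace H]

/-- A bounded operator is a partial isometry if it is isometric on the orthogonal complement of
its kernel. -/
def IsPartialIsometry (U : H →L[ℂ] H) : Prop :=
  ∀ x ∈ (LinearMap.ker U.toLinearMap)ᗮ, ‖U x‖ = ‖x‖

/-- `U` is the partial isometry of the polar decomposition `T = U |T|`, where
`|T| = (T* T)^(1/2)` is `CFC.abs T`. -/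
structure IsPolarFactor (T U : H →L[ℂ] H) : Prop where
  isPartialIsometry : IsPartialIsometry U
  eq_mul_abs : T = U * CFC.abs T
  ker_eq : LinearMap.ker U.toLinearMap = LinearMap.ker T.toLinearMap
  ker_adjoint_eq : LinearMap.ker (ContinuousLinearMap.adjoint U).toLinearMap =
    LinearMap.ker (ContinuousLinearMap.adjoint T).toLinearMap

theorem adjoint_cfcAbs (T : H →L[ℂ] H) :
    ContinuousLinearMap.adjoint (CFC.abs T) = CFC.abs T :=
  (IsSelfAdjoint.of_nonneg (CFC.abs_nonneg T)).star_eq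

theorem norm_cfcAbs_apply (T : H →L[ℂ] H) (x : H) : ‖CFC.abs T x‖ = ‖T x‖ := by
  have h : CFC.abs T * CFC.abs T = ContinuousLinearMap.adjoint T * T := CFC.abs_mul_abs T
  have h1 : inner ℂ (CFC.abs T x) (CFC.abs T x) = inner ℂ (T x) (T x) := by
    rw [← ContinuousLinearMap.adjoint_inner_left, adjoint_cfcAbs,
      ← ContinuousLinearMap.adjoint_inner_left T]
    exact congrArg (fun S : H →L[ℂ] H => inner ℂ (S x) x) h
  rw [inner_self_eq_norm_sq_to_K, inner_self_eq_norm_sq_to_K] at h1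
  have h2 : ‖CFC.abs T x‖ ^ 2 = ‖T x‖ ^ 2 := by exact_mod_cast h1
  exact (sq_eq_sq₀ (norm_nonneg _) (norm_nonneg _)).1 h2

theorem ker_cfcAbs (T : H →L[ℂ] H) :
    LinearMap.ker (CFC.abs T).toLinearMap = LinearMap.ker T.toLinearMap := by
  ext x
  have := norm_cfcAbs_apply T x
  simp only [LinearMap.mem_ker, ContinuousLinearMap.coe_coe]
  rw [← norm_eq_zero, this, norm_eq_zero]

theorem orthogonal_range_cfcAbs (T : H →L[ℂ] H) :
    (LinearMap.range (CFC.abs T).toLinearMap)ᗮ = LinearMap.ker T.toLinearMap := by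
  have := ContinuousLinearMap.orthogonal_range (CFC.abs T)
  rw [adjoint_cfcAbs] at this
  rw [← ker_cfcAbs]
  exact this

theorem orthogonal_ker_eq (T : H →L[ℂ] H) :
    (LinearMap.ker T.toLinearMap)ᗮ = (LinearMap.range (CFC.abs T).toLinearMap).topologicalClosure := by
  rw [← orthogonal_range_cfcAbs, Submodule.orthogonal_orthogonal_eq_closure]

/-- Existence and uniqueness of the polar decomposition. -/
theorem existsUnique_isPolarFactor (T : H →L[ℂ] H) : ∃! U : H →L[ℂ] H, IsPolarFactor T U := by
  set A := CFC.abs T with hA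
  set R := LinearMap.range A.toLinearMap with hR
  set K := R.topologicalClosure with hK
  have hmem : ∀ x, A x ∈ K := fun x => R.le_topologicalClosure ⟨x, rfl⟩
  have : CompleteSpace K := (Submodule.isClosed_topologicalClosure R).completeSpace_coe
  let e : H →ₗ[ℂ] K := A.toLinearMap.codRestrict K hmem
  have hdense : DenseRange e := by
    rw [DenseRange, Subtype.dense_iff]
    intro x hx
    have h2 : (Subtype.val '' Set.range e) = (R : Set H) := by
      ext y
      constructor
      · rintro ⟨_, ⟨z, rfl⟩, rfl⟩
        exact ⟨z, rfl⟩
      · rintro ⟨z, rfl⟩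
        exact ⟨e z, ⟨z, rfl⟩, rfl⟩
    exact h2 ▸ hx
  have hnorm : ∀ x, ‖T.toLinearMap x‖ = ‖e x‖ := fun x => (norm_cfcAbs_apply T x).symm
  let V : K →L[ℂ] H := T.toLinearMap.extendOfNorm e
  have hV : ∀ x, V (e x) = T x := fun x =>
    LinearMap.extendOfNorm_eq hdense ⟨1, fun x => by rw [one_mul, hnorm]⟩ x
  have hVn : ∀ y, ‖V y‖ = ‖y‖ := by
    intro y
    refine hdense.induction_on y (isClosed_eq (by fun_prop) (by fun_prop)) ?_
    intro x
    rw [hV, ← hnorm]; rfl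
  let U : H →L[ℂ] H := V ∘L K.orthogonalProjectionOnto
  have hKo : Kᗮ = LinearMap.ker T.toLinearMap := by
    rw [hK, Submodule.orthogonal_closure]
    exact orthogonal_range_cfcAbs T
  have hUA : T = U * A := by
    ext x
    have : K.orthogonalProjectionOnto (A x) = e x :=
      Submodule.orthogonalProjectionOnto_mem_subspace_eq_self (e x)
    simp [U, this, hV]
  have hUker : LinearMap.ker U.toLinearMap = LinearMap.ker T.toLinearMap := by
    rw [← hKo]
    ext x
    simp only [LinearMap.mem_ker, ContinuousLinearMap.coe_coe, U, ContinuousLinearMap.comp_apply]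
    rw [← norm_eq_zero, hVn, norm_eq_zero, Submodule.orthogonalProjectionOnto_eq_zero_iff]
  have hoK : (LinearMap.ker T.toLinearMap)ᗮ = K := orthogonal_ker_eq T
  refine ⟨U, ⟨?_, hUA, hUker, ?_⟩, ?_⟩
  · intro x hx
    rw [hUker, hoK] at hx
    have : K.orthogonalProjectionOnto x = ⟨x, hx⟩ :=
      Submodule.orthogonalProjectionOnto_mem_subspace_eq_self (⟨x, hx⟩ : K)
    simp only [U, ContinuousLinearMap.comp_apply, this, hVn]
    rfl
  · have hTa : ContinuousLinearMap.adjoint T = A * ContinuousLinearMap.adjoint U := by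
      conv_lhs => rw [hUA]
      rw [ContinuousLinearMap.mul_def, ContinuousLinearMap.adjoint_comp, hA, adjoint_cfcAbs]
      rfl
    ext y
    simp only [LinearMap.mem_ker, ContinuousLinearMap.coe_coe]
    constructor
    · intro h
      rw [hTa, mul_apply_eq_comp, h, map_zero]
    · intro h
      rw [hTa, mul_apply_eq_comp] at h
      have h1 : ContinuousLinearMap.adjoint U y ∈ LinearMap.ker U.toLinearMap := by
        rw [hUker, ← ker_cfcAbs]
        exact h
      have h2 : inner ℂ (ContinuousLinearMap.adjoint U y) (ContinuousLinearMap.adjoint U y)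
          = (0 : ℂ) := by
        rw [ContinuousLinearMap.adjoint_inner_left]
        have h3 : U (ContinuousLinearMap.adjoint U y) = 0 := h1
        rw [h3, inner_zero_right]
      exact inner_self_eq_zero.1 h2
  · intro W hW
    have hWU : ∀ z ∈ K, W z = U z := by
      have hcl : IsClosed {z | W z = U z} := isClosed_eq W.continuous U.continuous
      have hsub : (R : Set H) ⊆ {z | W z = U z} := by
        rintro _ ⟨x, rfl⟩
        have h1 := congrArg (fun S : H →L[ℂ] H => S x) (hW.eq_mul_abs.symm.trans hUA)
        exact h1
      intro z hz
      exact closure_minimal hsub hcl hz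
    ext x
    have hx := Submodule.starProjection_add_starProjection_orthogonal (K := K) x
    have h1 : Kᗮ.starProjection x ∈ Kᗮ := Submodule.starProjection_apply_mem _ _
    have h2 : W (Kᗮ.starProjection x) = 0 := by
      have : Kᗮ.starProjection x ∈ LinearMap.ker W.toLinearMap := by
        rw [hW.ker_eq, ← hKo]; exact h1
      exact this
    have h3 : U (Kᗮ.starProjection x) = 0 := by
      have : Kᗮ.starProjection x ∈ LinearMap.ker U.toLinearMap := by
        rw [hUker, ← hKo]; exact h1
      exact this
    rw [← hx, map_add, map_add, h2, h3, hWU _ (Submodule.starProjection_apply_mem _ _)]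

/-- The partial isometry `U` in the polar decomposition `T = U |T|`. -/
def polarFactor (T : H →L[ℂ] H) : H →L[ℂ] H :=
  (existsUnique_isPolarFactor T).choose

theorem isPolarFactor_polarFactor (T : H →L[ℂ] H) : IsPolarFactor T (polarFactor T) :=
  (existsUnique_isPolarFactor T).choose_spec.1

/-- The Aluthge transform `|T|^(1/2) U |T|^(1/2)` of a bounded operator `T = U |T|`. -/
def aluthge (T : H →L[ℂ] H) : H →L[ℂ] H :=
  CFC.sqrt (CFC.abs T) * polarFactor T * CFC.sqrt (CFC.abs T)

/-- A bounded operator on a Hilbert space is subnormal if it is the restriction of a normal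
operator to an invariant subspace, that is, if `H` embeds isometrically into a Hilbert space `K`
carrying a normal operator `N` that extends `T`. -/
def IsSubnormalOperator (T : H →L[ℂ] H) : Prop :=
  ∃ (K : Type u) (_ : NormedAddCommGroup K) (_ : InnerProductSpace ℂ K) (_ : CompleteSpace K)
    (N : K →L[ℂ] K) (J : H →ₗᵢ[ℂ] K), IsStarNormal N ∧ ∀ x, N (J x) = J (T x)

end Operators

section Shifts

/-- The coordinates `(0, α₀ f₀, α₁ f₁, …)` of the image of `f` under the weighted shift. -/
def shiftCoord (α : ℕ → ℝ) (f : ℕ → ℂ) : ℕ → ℂ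
  | 0 => 0
  | n + 1 => (α n : ℂ) * f n

theorem hasSum_norm_sq_lp (f : lp (fun _ : ℕ => ℂ) 2) : HasSum (fun n => ‖f n‖ ^ 2) (‖f‖ ^ 2) := by
  have := lp.hasSum_norm (p := 2) (by norm_num) f
  simpa using this

theorem summable_shiftCoord {α : ℕ → ℝ} {C : ℝ} (hC : ∀ n, |α n| ≤ C)
    (f : lp (fun _ : ℕ => ℂ) 2) :
    Summable (fun n => ‖shiftCoord α f n‖ ^ 2) ∧
      ∑' n, ‖shiftCoord α f n‖ ^ 2 ≤ C ^ 2 * ‖f‖ ^ 2 := by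
  have hf := (hasSum_norm_sq_lp f).mul_left (C ^ 2)
  have hle : ∀ n, ‖shiftCoord α f (n + 1)‖ ^ 2 ≤ C ^ 2 * ‖f n‖ ^ 2 := by
    intro n
    simp only [shiftCoord, norm_mul, Complex.norm_real, Real.norm_eq_abs, mul_pow]
    gcongr
    exact hC n
  have hs : Summable (fun n => ‖shiftCoord α f (n + 1)‖ ^ 2) :=
    Summable.of_nonneg_of_le (fun n => by positivity) hle hf.summable
  have hs' : Summable (fun n => ‖shiftCoord α f n‖ ^ 2) := (summable_nat_add_iff 1).1 hs
  refine ⟨hs', ?_⟩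
  rw [hs'.tsum_eq_zero_add]
  simp only [shiftCoord, norm_zero, ne_eq, OfNat.ofNat_ne_zero, not_false_eq_true, zero_pow,
    zero_add]
  exact (hs.tsum_le_tsum hle hf.summable).trans_eq hf.tsum_eq

theorem memℓp_shiftCoord {α : ℕ → ℝ} (hα : ∃ C : ℝ, ∀ n, |α n| ≤ C)
    (f : lp (fun _ : ℕ => ℂ) 2) : Memℓp (shiftCoord α f) 2 := by
  obtain ⟨C, hC⟩ := hα
  apply memℓp_gen
  simpa using (summable_shiftCoord hC f).1

/-- The weighted shift on `ℓ²(ℕ, ℂ)` as a linear map. -/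
def shiftLinear (α : ℕ → ℝ) (hα : ∃ C : ℝ, ∀ n, |α n| ≤ C) :
    lp (fun _ : ℕ => ℂ) 2 →ₗ[ℂ] lp (fun _ : ℕ => ℂ) 2 where
  toFun f := ⟨shiftCoord α f, memℓp_shiftCoord hα f⟩
  map_add' f g := by
    ext n
    change shiftCoord α (fun k => f k + g k) n = shiftCoord α f n + shiftCoord α g n
    cases n <;> simp [shiftCoord, mul_add]
  map_smul' c f := by
    ext n
    change shiftCoord α (fun k => c * f k) n = c * shiftCoord α f n
    cases n <;> simp [shiftCoord, mul_left_comm]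

theorem exists_shiftLinear_bound (α : ℕ → ℝ) (hα : ∃ C : ℝ, ∀ n, |α n| ≤ C) :
    ∃ C : ℝ, ∀ f, ‖shiftLinear α hα f‖ ≤ C * ‖f‖ := by
  obtain ⟨C, hC⟩ := id hα
  have hC0 : 0 ≤ C := (abs_nonneg _).trans (hC 0)
  refine ⟨C, fun f => ?_⟩
  have h1 := (hasSum_norm_sq_lp (shiftLinear α hα f)).tsum_eq
  have h2 := (summable_shiftCoord hC f).2
  have h3 : ‖shiftLinear α hα f‖ ^ 2 ≤ (C * ‖f‖) ^ 2 := by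
    rw [← h1, mul_pow]
    exact h2
  exact (sq_le_sq₀ (norm_nonneg _) (by positivity)).1 h3

variable {H : Type u} [NormedAddCommGroup H] [InnerProductSpace ℂ H]

/-- The weighted shift `W_α e_n = α_n e_{n+1}` with bounded weight sequence `α`, relative to the
orthonormal basis `e` of the Hilbert space `H`. -/
def weightedShift (e : HilbertBasis ℕ ℂ H) (α : ℕ → ℝ) (hα : ∃ C : ℝ, ∀ n, |α n| ≤ C) :
    H →L[ℂ] H :=
  (e.repr.symm.toContinuousLinearEquiv : lp (fun _ : ℕ => ℂ) 2 →L[ℂ] H) ∘L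
    (shiftLinear α hα).mkContinuousOfExistsBound (exists_shiftLinear_bound α hα) ∘L
    (e.repr.toContinuousLinearEquiv : H →L[ℂ] lp (fun _ : ℕ => ℂ) 2)

theorem weightedShift_apply_basis (e : HilbertBasis ℕ ℂ H) (α : ℕ → ℝ)
    (hα : ∃ C : ℝ, ∀ n, |α n| ≤ C) (n : ℕ) :
    weightedShift e α hα (e n) = (α n : ℂ) • e (n + 1) := by
  apply e.repr.injective
  ext m
  have h : e.repr (weightedShift e α hα (e n)) = shiftLinear α hα (e.repr (e n)) := by
    simp [weightedShift]
  rw [h, map_smul, e.repr_self, e.repr_self, lp.coeFn_smul, Pi.smul_apply]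
  cases m with
  | zero => simp [shiftLinear, shiftCoord]
  | succ m =>
    by_cases hmn : m = n
    · subst hmn
      simp [shiftLinear, shiftCoord]
    · simp [shiftLinear, shiftCoord, hmn]

end Shifts

/-- The moments `γ₀ = 1`, `γ_k = α₀² α₁² ⋯ α_{k-1}²` of a weight sequence `α`. -/
def shiftMoment (α : ℕ → ℝ) (k : ℕ) : ℝ := ∏ i ∈ Finset.range k, α i ^ 2

/-- `μ` is a (nonnegative) representing measure on `ℝ` of the moment sequence `γ`. -/
def IsRepresentingMeasure (μ : Measure ℝ) (γ : ℕ → ℝ) : Prop :=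
  ∀ n, Integrable (fun t : ℝ => t ^ n) μ ∧ γ n = ∫ t, t ^ n ∂μ

end

/-! The Aluthge transform `T` is the shift with weights `√(αₙ αₙ₊₁)`, so `‖Tⁿ e₀‖⁴ = γₙ γₙ₊₁ / α₀²`.
If `T` has a normal extension `N`, then `‖T^(i+j) x‖²` is the Gram matrix of the vectors `(N*N)^i
x`. By Schur's product theorem its entrywise square is positive semidefinite
(`IsSubnormalOperator.isHankelNonneg_norm_pow`). Taking `x = e₀` and `x = T e₀`, both `γₙ γₙ₊₁` and
its shift have nonnegative Hankel forms. Expanding `γₙ γₙ₊₁` over the atoms gives a finite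
exponential sum, in which such positivity forbids an isolated negative base
(`IsHankelNonneg.coeff_eq_zero`). The base `-pq` has coefficient `ac(q-p)`, hence `p = q`; then if
`r ≠ 0`, one of `±pr` is negative with nonzero coefficient. Conversely, for atoms `-p, 0, p` all
weights of `T` after the first equal `√p`, and the first is no larger. Such a shift extends to a
multiple of a bilateral shift plus a zero summand (`isSubnormalOperator_of_constant_weights`). -/

/-! ### Polar decomposition and Aluthge transform of a weighted shift. -/

section Operators

variable {H : Type u} [NormedAddCommGroup H] [InnerProductSpace ℂ H] [CompleteSpace H]

/-- The square root of a positive operator acts on an eigenvector with positive eigenvalue by the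
square root of the eigenvalue. -/
theorem sqrt_apply_of_apply_eq_smul {A : H →L[ℂ] H} (hA : 0 ≤ A) {t : ℝ} (ht : 0 < t) {x : H}
    (hx : A x = (t : ℂ) • x) : CFC.sqrt A x = ((√t : ℝ) : ℂ) • x := by
  set B := CFC.sqrt A with hB
  have hBB : B * B = A := CFC.sqrt_mul_sqrt_self A hA
  have hBpos : B.IsPositive :=
    (ContinuousLinearMap.nonneg_iff_isPositive B).1 (CFC.sqrt_nonneg A)
  have hs : 0 < √t := Real.sqrt_pos.2 ht
  -- Since `(B + √t)(B - √t) x = 0`, `y` satisfies `B y = -√t y`, which positivity of `B` allows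
  -- only for `y = 0`.
  set y := B x - ((√t : ℝ) : ℂ) • x with hy
  have hBy : B y = -((√t : ℝ) : ℂ) • y := by
    have h1 : B (B x) = (t : ℂ) • x := by
      rw [← hx, ← hBB]; rfl
    have h2 : (t : ℂ) = ((√t : ℝ) : ℂ) * ((√t : ℝ) : ℂ) := by
      exact_mod_cast (Real.mul_self_sqrt ht.le).symm
    rw [hy, map_sub, map_smul, h1, h2, smul_sub, neg_smul, neg_smul, smul_smul]
    abel
  have h3 : 0 ≤ RCLike.re (inner ℂ y (B y)) := hBpos.re_inner_nonneg_right y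
  rw [hBy, inner_smul_right, inner_self_eq_norm_sq_to_K] at h3
  have h4 : (-((√t : ℝ) : ℂ) * ((‖y‖ : ℝ) : ℂ) ^ 2) = ((-(√t * ‖y‖ ^ 2) : ℝ) : ℂ) := by
    push_cast; ring
  have h5 : 0 ≤ -(√t * ‖y‖ ^ 2) := by
    have h6 : RCLike.re (-((√t : ℝ) : ℂ) * ((‖y‖ : ℝ) : ℂ) ^ 2) = -(√t * ‖y‖ ^ 2) := by
      rw [h4]; exact Complex.ofReal_re _
    rw [← h6]; exact h3
  have h7 : ‖y‖ ^ 2 = 0 := by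
    have := sq_nonneg ‖y‖
    nlinarith
  have h8 : y = 0 := by simpa using h7
  exact sub_eq_zero.1 h8

theorem ContinuousLinearMap.ext_hilbertBasis {ι E F : Type*} [NormedAddCommGroup E]
    [InnerProductSpace ℂ E] [NormedAddCommGroup F] [NormedSpace ℂ F] (e : HilbertBasis ι ℂ E)
    {S T : E →L[ℂ] F}
    (h : ∀ i, S (e i) = T (e i)) : S = T := by
  refine ContinuousLinearMap.ext_on (s := Set.range e) ?_ ?_
  · exact Submodule.dense_iff_topologicalClosure_eq_top.2 e.dense_span
  · rintro _ ⟨i, rfl⟩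
    exact h i

theorem HilbertBasis.ext_inner {ι E : Type*} [NormedAddCommGroup E] [InnerProductSpace ℂ E]
    (e : HilbertBasis ι ℂ E) {x y : E}
    (h : ∀ i, inner ℂ (e i) x = inner ℂ (e i) y) : x = y := by
  apply e.repr.injective
  ext i
  rw [e.repr_apply_apply, e.repr_apply_apply, h]

section Aluthge

variable (e : HilbertBasis ℕ ℂ H) {α : ℕ → ℝ} (hbdd : ∃ C : ℝ, ∀ n, |α n| ≤ C)

theorem adjoint_weightedShift_apply_succ (n : ℕ) :
    ContinuousLinearMap.adjoint (weightedShift e α hbdd) (e (n + 1)) = (α n : ℂ) • e n := by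
  refine e.ext_inner fun i => ?_
  rw [ContinuousLinearMap.adjoint_inner_right, weightedShift_apply_basis, inner_smul_left,
    inner_smul_right, orthonormal_iff_ite.1 e.orthonormal, orthonormal_iff_ite.1 e.orthonormal]
  by_cases h : i = n <;> simp [h]

variable (hpos : ∀ n, 0 < α n)
include hpos

theorem cfcAbs_weightedShift_apply (n : ℕ) :
    CFC.abs (weightedShift e α hbdd) (e n) = (α n : ℂ) • e n := by
  have h : (star (weightedShift e α hbdd) * weightedShift e α hbdd) (e n) =
      ((α n ^ 2 : ℝ) : ℂ) • e n := by
    change ContinuousLinearMap.adjoint (weightedShift e α hbdd) (weightedShift e α hbdd (e n)) = _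
    rw [weightedShift_apply_basis, map_smul, adjoint_weightedShift_apply_succ, smul_smul]
    push_cast
    rw [sq]
  have := sqrt_apply_of_apply_eq_smul (star_mul_self_nonneg _) (pow_pos (hpos n) 2) h
  rwa [Real.sqrt_sq (hpos n).le] at this

theorem polarFactor_weightedShift_apply (n : ℕ) :
    polarFactor (weightedShift e α hbdd) (e n) = e (n + 1) := by
  have h := congrArg (fun S : H →L[ℂ] H => S (e n))
    (isPolarFactor_polarFactor (weightedShift e α hbdd)).eq_mul_abs
  have h2 : weightedShift e α hbdd (e n) =
    polarFactor (weightedShift e α hbdd) (CFC.abs (weightedShift e α hbdd) (e n)) := h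
  rw [weightedShift_apply_basis, cfcAbs_weightedShift_apply e hbdd hpos, map_smul] at h2
  have hne : (α n : ℂ) ≠ 0 := by exact_mod_cast (hpos n).ne'
  exact (smul_right_injective H hne h2).symm

/-- The Aluthge transform of a weighted shift is the weighted shift with weights
`√αₙ √αₙ₊₁`. -/
theorem aluthge_weightedShift_apply (n : ℕ) :
    aluthge (weightedShift e α hbdd) (e n) =
      ((√(α n) * √(α (n + 1)) : ℝ) : ℂ) • e (n + 1) := by
  have h (k : ℕ) := sqrt_apply_of_apply_eq_smul (CFC.abs_nonneg (weightedShift e α hbdd)) (hpos k)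
    (cfcAbs_weightedShift_apply e hbdd hpos k)
  change CFC.sqrt (CFC.abs (weightedShift e α hbdd)) (polarFactor (weightedShift e α hbdd)
    (CFC.sqrt (CFC.abs (weightedShift e α hbdd)) (e n))) = _
  rw [h, map_smul, polarFactor_weightedShift_apply e hbdd hpos, map_smul, h, smul_smul]
  push_cast
  rfl

end Aluthge

end Operators

/-! ### Hankel positivity, exponential sums and normal extensions. -/

section Positivity

open scoped ComplexOrder in
/-- The quadratic form of the entrywise square of a real Gram matrix is nonnegative. -/
theorem sum_mul_inner_sq_nonneg {E : Type*} [NormedAddCommGroup E] [InnerProductSpace ℂ E]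
    {n : ℕ} (v : Fin n → E) (g : Fin n → Fin n → ℝ) (hg : ∀ i j, inner ℂ (v i) (v j) = (g i j : ℂ))
    (c : Fin n → ℝ) : 0 ≤ ∑ i, ∑ j, c i * c j * g i j ^ 2 := by
  -- Schur product theorem.
  have h := ((Matrix.posSemidef_gram ℂ v).hadamard
    (Matrix.posSemidef_gram ℂ v)).dotProduct_mulVec_nonneg (fun i => (c i : ℂ))
  have h2 : dotProduct (star fun i => (c i : ℂ)) (Matrix.mulVec
      ((Matrix.gram ℂ v).hadamard (Matrix.gram ℂ v)) fun i => (c i : ℂ)) =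
      ((∑ i, ∑ j, c i * c j * g i j ^ 2 : ℝ) : ℂ) := by
    simp only [dotProduct, Matrix.mulVec, Matrix.hadamard_apply, Matrix.gram_apply, hg,
      Pi.star_apply, RCLike.star_def, Complex.conj_ofReal, Finset.mul_sum]
    push_cast
    refine Finset.sum_congr rfl fun i _ => Finset.sum_congr rfl fun j _ => ?_
    ring
  rw [h2] at h
  exact_mod_cast h

/-- All Hankel quadratic forms of the sequence `s` are nonnegative. -/
def IsHankelNonneg (s : ℕ → ℝ) : Prop :=
  ∀ (n : ℕ) (c : Fin n → ℝ), 0 ≤ ∑ i, ∑ j, c i * c j * s (i + j)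

theorem IsHankelNonneg.const_mul {s : ℕ → ℝ} (hs : IsHankelNonneg s) {k : ℝ} (hk : 0 ≤ k) :
    IsHankelNonneg fun n => k * s n := by
  intro n c
  have := mul_nonneg hk (hs n c)
  simp only [Finset.mul_sum] at this
  refine this.trans_eq (Finset.sum_congr rfl fun i _ => Finset.sum_congr rfl fun j _ => ?_)
  ring

/-- The Hankel form at the coefficient vector of `P` is the integral of `P²` against the signed
measure with weights `w k` at `x k`. -/
theorem IsHankelNonneg.sum_mul_eval_sq_nonneg {ι : Type*} [Fintype ι] {s : ℕ → ℝ}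
    (hs : IsHankelNonneg s) {w x : ι → ℝ} (h : ∀ n, s n = ∑ k, w k * x k ^ n)
    (P : Polynomial ℝ) : 0 ≤ ∑ k, w k * P.eval (x k) ^ 2 := by
  refine (hs (P.natDegree + 1) fun i => P.coeff i).trans_eq ?_
  simp only [h, Finset.mul_sum]
  have : ∀ k, w k * P.eval (x k) ^ 2 = ∑ i : Fin (P.natDegree + 1), ∑ j : Fin (P.natDegree + 1),
      P.coeff i * P.coeff j * (w k * x k ^ (i + j : ℕ)) := by
    intro k
    rw [P.eval_eq_sum_range, ← Fin.sum_univ_eq_sum_range (fun i => P.coeff i * x k ^ i), sq,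
      Finset.sum_mul_sum, Finset.mul_sum]
    refine Finset.sum_congr rfl fun i _ => ?_
    rw [Finset.mul_sum]
    refine Finset.sum_congr rfl fun j _ => ?_
    ring
  simp only [this]
  rw [Finset.sum_comm]
  conv_rhs => rw [Finset.sum_comm]
  rw [Finset.sum_comm]
  refine Finset.sum_congr rfl fun i _ => ?_
  rw [Finset.sum_comm]

/-- If a finite exponential sum and its shift have nonnegative Hankel forms, then the
coefficient at an isolated negative base vanishes. -/
theorem IsHankelNonneg.coeff_eq_zero {ι : Type*} [Fintype ι] {s : ℕ → ℝ}
    (hs : IsHankelNonneg s) (hs' : IsHankelNonneg fun n => s (n + 1)) {w x : ι → ℝ}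
    (h : ∀ n, s n = ∑ k, w k * x k ^ n) {k₀ : ι} (hneg : x k₀ < 0)
    (hne : ∀ k ≠ k₀, w k = 0 ∨ x k ≠ x k₀) : w k₀ = 0 := by
  classical
  set S := Finset.univ.filter fun k => x k ≠ x k₀
  -- `P` isolates the base `x k₀`: the two Hankel conditions then say `w k₀ ≥ 0` and `w k₀ * x k₀ ≥
  -- 0`.
  set P : Polynomial ℝ := ∏ k ∈ S, (Polynomial.X - Polynomial.C (x k)) with hP
  have hP0 : P.eval (x k₀) ≠ 0 := by
    rw [hP, Polynomial.eval_prod, Finset.prod_ne_zero_iff]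
    intro k hk
    simpa [sub_eq_zero] using (Finset.mem_filter.1 hk).2.symm
  have hPk : ∀ k ≠ k₀, w k = 0 ∨ P.eval (x k) = 0 := by
    intro k hk
    refine (hne k hk).imp_right fun hx => ?_
    rw [hP, Polynomial.eval_prod]
    exact Finset.prod_eq_zero (i := k) (by simp [S, hx]) (by simp)
  have h0 := hs.sum_mul_eval_sq_nonneg h P
  have h1 := hs'.sum_mul_eval_sq_nonneg (w := fun k => w k * x k) (x := x)
    (fun n => by rw [h]; exact Finset.sum_congr rfl fun k _ => by ring) P
  rw [Finset.sum_eq_single k₀ (fun k _ hk => by rcases hPk k hk with h | h <;> simp [h])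
    (by simp)] at h0 h1
  have hsq : 0 < P.eval (x k₀) ^ 2 := by positivity
  have h2 : 0 ≤ w k₀ := nonneg_of_mul_nonneg_left h0 hsq
  have h3 : 0 ≤ w k₀ * x k₀ := nonneg_of_mul_nonneg_left h1 hsq
  nlinarith

/-- Normality gives `(N*N)^m = (N*)^m N^m`, and `N*N` is selfadjoint. -/
theorem IsStarNormal.inner_pow_apply {K : Type*} [NormedAddCommGroup K] [InnerProductSpace ℂ K]
    [CompleteSpace K] {N : K →L[ℂ] K} (hN : IsStarNormal N) (y z : K) (i j : ℕ) :
    inner ℂ (((star N * N) ^ i) y) (((star N * N) ^ j) z) =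
      inner ℂ ((N ^ (i + j)) y) ((N ^ (i + j)) z) := by
  have hA : star (star N * N) = star N * N := by simp
  have hc : Commute (star N) N := hN.star_comm_self
  have h : star ((star N * N) ^ i) * (star N * N) ^ j = star (N ^ (i + j)) * N ^ (i + j) := by
    rw [star_pow, hA, ← pow_add, hc.mul_pow, star_pow]
  have h2 := congrArg (fun S : K →L[ℂ] K => inner ℂ y (S z)) h
  simpa only [ContinuousLinearMap.star_eq_adjoint, mul_apply_eq_comp,
    ContinuousLinearMap.adjoint_inner_right] using h2

theorem IsSubnormalOperator.isHankelNonneg_norm_pow {H : Type u} [NormedAddCommGroup H]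
    [InnerProductSpace ℂ H] {T : H →L[ℂ] H} (hT : IsSubnormalOperator T) (x : H) : IsHankelNonneg fun n => (‖(T ^ n) x‖ ^ 2) ^ 2 := by
  obtain ⟨K, _, _, _, N, J, hN, hJ⟩ := hT
  have hpow : ∀ n, (N ^ n) (J x) = J ((T ^ n) x) := by
    intro n
    induction n with
    | zero => simp
    | succ n ih => rw [pow_succ', pow_succ', mul_apply_eq_comp, mul_apply_eq_comp, ih, hJ]
  intro n c
  refine sum_mul_inner_sq_nonneg (fun i : Fin n => ((star N * N) ^ (i : ℕ)) (J x))
    (fun i j => ‖(T ^ (i + j : ℕ)) x‖ ^ 2) (fun i j => ?_) c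
  rw [hN.inner_pow_apply, hpow, J.inner_map_map, inner_self_eq_norm_sq_to_K]
  push_cast
  rfl

end Positivity

/-! ### Products of consecutive moments and the necessity of symmetry. -/

section Moments

variable {H : Type u} [NormedAddCommGroup H] [InnerProductSpace ℂ H] [CompleteSpace H]
  (e : HilbertBasis ℕ ℂ H) {α : ℕ → ℝ} (hbdd : ∃ C : ℝ, ∀ n, |α n| ≤ C) (hpos : ∀ n, 0 < α n)

theorem shiftMoment_succ (α : ℕ → ℝ) (n : ℕ) :
    shiftMoment α (n + 1) = shiftMoment α n * α n ^ 2 :=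
  Finset.prod_range_succ _ _

theorem shiftMoment_mul_shiftMoment_succ (α : ℕ → ℝ) (n : ℕ) :
    shiftMoment α n * shiftMoment α (n + 1) =
      α 0 ^ 2 * (∏ i ∈ Finset.range n, α i * α (i + 1)) ^ 2 := by
  induction n with
  | zero => simp [shiftMoment]
  | succ n ih =>
    rw [shiftMoment_succ α (n + 1), Finset.prod_range_succ, mul_pow, ← mul_assoc (α 0 ^ 2), ← ih,
      shiftMoment_succ]
    ring

include hpos in
theorem aluthge_weightedShift_pow_apply_zero (n : ℕ) :
    (aluthge (weightedShift e α hbdd) ^ n) (e 0) =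
      ((∏ i ∈ Finset.range n, √(α i) * √(α (i + 1)) : ℝ) : ℂ) • e n := by
  induction n with
  | zero => simp
  | succ n ih =>
    rw [pow_succ', mul_apply_eq_comp, ih, map_smul, aluthge_weightedShift_apply e hbdd hpos,
      smul_smul, Finset.prod_range_succ]
    push_cast
    rfl

include hpos in
theorem norm_sq_aluthge_weightedShift_pow (n : ℕ) :
    ‖(aluthge (weightedShift e α hbdd) ^ n) (e 0)‖ ^ 2 =
      ∏ i ∈ Finset.range n, α i * α (i + 1) := by
  rw [aluthge_weightedShift_pow_apply_zero e hbdd hpos, norm_smul, e.orthonormal.1 n, mul_one,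
    Complex.norm_real, Real.norm_eq_abs, sq_abs, ← Finset.prod_pow]
  refine Finset.prod_congr rfl fun i _ => ?_
  rw [mul_pow, Real.sq_sqrt (hpos i).le, Real.sq_sqrt (hpos _).le]

include hpos in
theorem isHankelNonneg_shiftMoment_mul
    (hT : IsSubnormalOperator (aluthge (weightedShift e α hbdd))) :
    IsHankelNonneg (fun n => shiftMoment α n * shiftMoment α (n + 1)) ∧
      IsHankelNonneg (fun n => shiftMoment α (n + 1) * shiftMoment α (n + 1 + 1)) := by
  have h (n : ℕ) : shiftMoment α n * shiftMoment α (n + 1) =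
      α 0 ^ 2 * (‖(aluthge (weightedShift e α hbdd) ^ n) (e 0)‖ ^ 2) ^ 2 := by
    rw [norm_sq_aluthge_weightedShift_pow e hbdd hpos, shiftMoment_mul_shiftMoment_succ]
  simp only [h]
  refine ⟨(hT.isHankelNonneg_norm_pow (e 0)).const_mul (sq_nonneg _), ?_⟩
  -- Starting from `T e₀` instead of `e₀` shifts the sequence by one.
  have h' := (hT.isHankelNonneg_norm_pow (aluthge (weightedShift e α hbdd) (e 0))).const_mul
    (sq_nonneg (α 0))
  simpa only [pow_succ _ _, mul_apply_eq_comp] using h'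

theorem IsRepresentingMeasure.eq_of_three_atoms {γ : ℕ → ℝ} {a b c x y z : ℝ} (ha : 0 ≤ a)
    (hb : 0 ≤ b) (hc : 0 ≤ c)
    (hμ : IsRepresentingMeasure (ENNReal.ofReal a • Measure.dirac x +
      ENNReal.ofReal b • Measure.dirac y + ENNReal.ofReal c • Measure.dirac z) γ) (n : ℕ) :
    γ n = a * x ^ n + b * y ^ n + c * z ^ n := by
  obtain ⟨h1, h2⟩ := hμ n
  have h3 := (integrable_add_measure.1 h1)
  have h4 := (integrable_add_measure.1 h3.1)
  rw [h2, integral_add_measure h3.1 h3.2, integral_add_measure h4.1 h4.2]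
  simp [ha, hb, hc, integral_smul_measure]

/-- If the products `γₙ γₙ₊₁` of consecutive moments of a three-atom measure form a sequence
with the positivity of a moment sequence on `[0, ∞)`, the measure is symmetric in its support. -/
theorem eq_zero_and_eq_of_isHankelNonneg {γ : ℕ → ℝ} {a b c p q r : ℝ} (ha : 0 < a) (hb : 0 < b)
    (hc : 0 < c) (hp : 0 < p) (hpr : -p < r) (hrq : r < q) (hq : 0 < q)
    (hγ : ∀ n, γ n = a * (-p) ^ n + b * r ^ n + c * q ^ n)
    (h0 : IsHankelNonneg fun n => γ n * γ (n + 1))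
    (h1 : IsHankelNonneg fun n => γ (n + 1) * γ (n + 1 + 1)) : r = 0 ∧ p = q := by
  have hsign (n : ℕ) : (-1 : ℝ) ^ n * (-1) ^ n = 1 := by
    rw [← mul_pow]; norm_num
  have hpq : p = q := by
    -- The cross terms of two atoms `u, v` combine to coefficient times `(u + v) (u v)ⁿ`; index `0`
    -- is the base `-(p * q)`.
    have h := h0.coeff_eq_zero h1 (ι := Fin 6)
      (w := ![a * c * (q - p), a * b * (r - p), b * c * (r + q), -(a ^ 2 * p), b ^ 2 * r, c ^ 2 * q])
      (x := ![-(p * q), -(p * r), r * q, p ^ 2, r ^ 2, q ^ 2])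
      (fun n => by
        simp only [hγ, Fin.sum_univ_succ, Fin.sum_univ_zero, Matrix.cons_val_zero,
          Matrix.cons_val_succ, pow_succ, neg_pow (p * q), neg_pow (p * r), mul_pow, neg_pow p]
        linear_combination -(a ^ 2 * p * (p ^ n) ^ 2) * hsign n) (k₀ := 0) (by simpa using mul_pos hp hq)
      (fun k hk => by
        right
        have := mul_pos hp hq
        fin_cases k <;> simp at hk ⊢
        · exact ⟨hrq.ne, hp.ne'⟩
        · intro h; nlinarith
        · nlinarith
        · nlinarith
        · nlinarith)
    have h2 : a * c * (q - p) = 0 := h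
    have h3 := (mul_eq_zero.1 h2).resolve_left (mul_pos ha hc).ne'
    linarith
  subst hpq
  refine ⟨?_, rfl⟩
  -- With `q = p` the term at `-p²` vanishes and the two terms at `p²` merge.
  have hexp (n : ℕ) : γ n * γ (n + 1) = ∑ k : Fin 4,
      ![a * b * (r - p), b * c * (r + p), (c ^ 2 - a ^ 2) * p, b ^ 2 * r] k *
        ![-(p * r), p * r, p ^ 2, r ^ 2] k ^ n := by
    simp only [hγ, Fin.sum_univ_succ, Fin.sum_univ_zero, Matrix.cons_val_zero,
      Matrix.cons_val_succ, pow_succ, neg_pow (p * r), mul_pow, neg_pow p]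
    linear_combination -(a ^ 2 * p * (p ^ n) ^ 2) * hsign n
  rcases lt_trichotomy r 0 with hr | hr | hr
  · have hpr' : p * r < 0 := mul_neg_of_pos_of_neg hp hr
    have h := h0.coeff_eq_zero h1 hexp (k₀ := 1) (by simpa using hpr')
      (fun k hk => by
        right
        fin_cases k <;> simp at hk ⊢ <;> nlinarith)
    have h2 : b * c * (r + p) = 0 := h
    have : 0 < b * c * (r + p) := mul_pos (mul_pos hb hc) (by linarith)
    linarith
  · exact hr
  · have hpr' : 0 < p * r := mul_pos hp hr
    have h := h0.coeff_eq_zero h1 hexp (k₀ := 0) (by simpa using hpr')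
      (fun k hk => by
        right
        fin_cases k <;> simp at hk ⊢ <;> nlinarith)
    have h2 : a * b * (r - p) = 0 := h
    have : 0 < a * b * (p - r) := mul_pos (mul_pos ha hb) (by linarith)
    linarith

end Moments

/-! ### Construction of a normal extension in the symmetric case. -/

section NormalExtension

theorem HilbertBasis.exists_reindex {ι ι' E : Type*} [NormedAddCommGroup E]
    [InnerProductSpace ℂ E] [CompleteSpace E] (e : HilbertBasis ι ℂ E) (σ : ι' ≃ ι) :
    ∃ f : HilbertBasis ι' ℂ E, ∀ i, f i = e (σ i) := by
  refine ⟨HilbertBasis.mk (e.orthonormal.comp σ σ.injective) ?_, fun i => ?_⟩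
  · rw [σ.surjective.range_comp, e.dense_span]
  · rw [HilbertBasis.coe_mk]; rfl

theorem HilbertBasis.exists_linearIsometryEquiv {ι E F : Type*} [NormedAddCommGroup E]
    [InnerProductSpace ℂ E] [NormedAddCommGroup F] [InnerProductSpace ℂ F]
    (e : HilbertBasis ι ℂ E) (f : HilbertBasis ι ℂ F) :
    ∃ U : E ≃ₗᵢ[ℂ] F, ∀ i, U (e i) = f i := by
  classical
  refine ⟨e.repr.trans f.repr.symm, fun i => ?_⟩
  rw [LinearIsometryEquiv.trans_apply, e.repr_self, f.repr_symm_single]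

theorem HilbertBasis.exists_linearIsometry {ι E F : Type*} [NormedAddCommGroup E]
    [InnerProductSpace ℂ E] [NormedAddCommGroup F] [InnerProductSpace ℂ F] [CompleteSpace F]
    (e : HilbertBasis ι ℂ E) {v : ι → F} (hv : Orthonormal ℂ v) :
    ∃ J : E →ₗᵢ[ℂ] F, ∀ i, J (e i) = v i := by
  classical
  refine ⟨hv.orthogonalFamily.linearIsometry.comp e.repr.toLinearIsometry, fun i => ?_⟩
  change hv.orthogonalFamily.linearIsometry (e.repr (e i)) = v i
  rw [e.repr_self, OrthogonalFamily.linearIsometry_apply_single]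
  simp

/-- Removing a fixed selfadjoint idempotent from a unitary leaves a normal element. -/
theorem isStarNormal_unitary_sub {R : Type*} [Ring R] [StarRing R] {U P : R}
    (hU : U ∈ unitary R) (hP : IsSelfAdjoint P) (hUP : U * P = P) : IsStarNormal (U - P) := by
  have h1 : star U * P = P := by
    conv_lhs => rw [← hUP, ← mul_assoc, Unitary.star_mul_self_of_mem hU, one_mul]
  have h2 : P * U = P := by
    have := congrArg star h1
    rwa [star_mul, star_star, hP.star_eq] at this
  have h3 : P * star U = P := by
    have := congrArg star hUP
    rwa [star_mul, hP.star_eq] at this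
  constructor
  rw [commute_iff_eq, star_sub, hP.star_eq, sub_mul, sub_mul, mul_sub, mul_sub, mul_sub, mul_sub,
    h1, h2, h3, hUP, Unitary.star_mul_self_of_mem hU, Unitary.mul_star_self_of_mem hU]

/-- On a Hilbert space with a basis indexed by `ℤ` and one more point, the bilateral shift
extended by zero is normal. -/
theorem HilbertBasis.exists_isStarNormal_shift {E : Type*} [NormedAddCommGroup E]
    [InnerProductSpace ℂ E] [CompleteSpace E] (f : HilbertBasis (Option ℤ) ℂ E) :
    ∃ N : E →L[ℂ] E, IsStarNormal N ∧ N (f none) = 0 ∧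
      ∀ k : ℤ, N (f (some k)) = f (some (k + 1)) := by
  -- The reindexing translates `ℤ` and fixes `none`, giving a unitary; subtracting the projection
  -- onto `f none` replaces the fixed vector by a kernel vector.
  obtain ⟨f', hf'⟩ := f.exists_reindex (Equiv.optionCongr (Equiv.addRight (1 : ℤ)))
  obtain ⟨V, hV⟩ := f.exists_linearIsometryEquiv f'
  set U : E →L[ℂ] E := (V.toContinuousLinearEquiv : E →L[ℂ] E) with hUdef
  have hUV (x : E) : U x = V x := rfl
  have hU : U ∈ unitary (E →L[ℂ] E) := (Unitary.linearIsometryEquiv.symm V).2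
  set P : E →L[ℂ] E := (ℂ ∙ f none).starProjection
  have hPx (x : E) : P x = inner ℂ (f none) x • f none :=
    Submodule.starProjection_unit_singleton ℂ (f.orthonormal.1 none) x
  have hUg : U (f none) = f none := by
    rw [hUV, hV, hf']; rfl
  refine ⟨U - P, isStarNormal_unitary_sub hU (isSelfAdjoint_starProjection _) ?_, ?_, fun k => ?_⟩
  · ext x
    rw [mul_apply_eq_comp, hPx, map_smul, hUg]
  · rw [sub_apply, hUg, hPx, inner_self_eq_norm_sq_to_K, f.orthonormal.1]
    simp
  · rw [sub_apply, hUV, hV, hf', hPx, f.orthonormal.2 (by simp)]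
    simp

variable {H : Type u} [NormedAddCommGroup H] [InnerProductSpace ℂ H] [CompleteSpace H]

/-- A unilateral shift with constant weights is subnormal if its first weight is decreased. -/
theorem isSubnormalOperator_of_constant_weights (e : HilbertBasis ℕ ℂ H) {T : H →L[ℂ] H}
    {s k : ℝ} (hs : s ^ 2 ≤ 1) (h0 : T (e 0) = ((s * k : ℝ) : ℂ) • e 1)
    (h1 : ∀ n, T (e (n + 1)) = (k : ℂ) • e (n + 2)) : IsSubnormalOperator T := by
  -- `H` itself, reindexed, carries the normal extension.
  obtain ⟨f, -⟩ := e.exists_reindex (Denumerable.eqv (Option ℤ))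
  obtain ⟨N, hN, hN0, hN1⟩ := f.exists_isStarNormal_shift
  have hf := orthonormal_iff_ite.1 f.orthonormal
  -- `e 0` is sent to a unit vector whose `none` component is killed by `N`, which leaves the
  -- reduced first weight `s * k`.
  set τ := √(1 - s ^ 2) with hτ
  have hτ2 : τ * τ = 1 - s ^ 2 := Real.mul_self_sqrt (by linarith)
  let v : ℕ → H := fun n => Nat.casesOn n ((s : ℂ) • f (some 0) + (τ : ℂ) • f none)
    fun m => f (some ((m + 1 : ℕ) : ℤ))
  have hv0 : v 0 = (s : ℂ) • f (some 0) + (τ : ℂ) • f none := rfl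
  have hv1 (n : ℕ) : v (n + 1) = f (some ((n + 1 : ℕ) : ℤ)) := rfl
  have hv : Orthonormal ℂ v := by
    rw [orthonormal_iff_ite]
    have hne (n : ℕ) : ((n + 1 : ℕ) : ℤ) ≠ 0 := by omega
    rintro (_ | i) (_ | j)
    · have : (s : ℂ) * s + τ * τ = 1 := by
        exact_mod_cast (by rw [hτ2]; ring : s * s + τ * τ = 1)
      simp only [hv0, inner_add_left, inner_add_right, inner_smul_left, inner_smul_right, hf]
      simpa using this
    · simp only [hv0, hv1, inner_add_left, inner_smul_left, hf, Option.some.injEq, (hne j).symm,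
        reduceCtorEq, if_false, mul_zero, add_zero]
    · simp only [hv0, hv1, inner_add_right, inner_smul_right, hf, Option.some.injEq, hne i,
        reduceCtorEq, if_false, mul_zero, add_zero]
    · simp [hv1, hf]
  obtain ⟨J, hJ⟩ := e.exists_linearIsometry hv
  refine ⟨H, _, _, inferInstance, (k : ℂ) • N, J, ?_, fun x => ?_⟩
  · constructor
    rw [star_smul]
    exact (hN.star_comm_self.smul_left _).smul_right _
  · have h : ((k : ℂ) • N) ∘L J.toContinuousLinearMap = J.toContinuousLinearMap ∘L T := by
      refine ContinuousLinearMap.ext_hilbertBasis e fun n => ?_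
      change (k : ℂ) • N (J (e n)) = J (T (e n))
      rcases n with _ | n
      · rw [h0, map_smul, hJ, hJ, hv0, map_add, map_smul, map_smul, hN0, hN1, smul_zero, add_zero,
          smul_smul, show v 1 = f (some (0 + 1)) from rfl]
        push_cast
        rw [mul_comm]
      · rw [h1, map_smul, hJ, hJ, hv1, hv1, hN1]
        push_cast
        rfl
    exact congrArg (fun S : H →L[ℂ] H => S x) h

/-- If the moments come from a three-atom measure with atoms at `-p`, `0` and `p`, the Aluthge
transform has constant weights from the second one on. -/
theorem isSubnormalOperator_aluthge_of_symmetric (e : HilbertBasis ℕ ℂ H) {α : ℕ → ℝ}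
    (hpos : ∀ n, 0 < α n) (hbdd : ∃ C : ℝ, ∀ n, |α n| ≤ C) {a b c p : ℝ} (ha : 0 < a)
    (hb : 0 < b) (hc : 0 < c) (hp : 0 < p)
    (hγ : ∀ n, shiftMoment α n = a * (-p) ^ n + b * 0 ^ n + c * p ^ n) :
    IsSubnormalOperator (aluthge (weightedShift e α hbdd)) := by
  have hγpos (n : ℕ) : 0 < shiftMoment α n := Finset.prod_pos fun i _ => pow_pos (hpos i) 2
  have hstep (n : ℕ) : shiftMoment α n * (α n * α (n + 1)) ^ 2 = shiftMoment α (n + 2) := by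
    rw [shiftMoment_succ α (n + 1), shiftMoment_succ]; ring
  have hsum : a + b + c = 1 := by
    have := hγ 0
    simp [shiftMoment] at this
    exact this.symm
  have hα (n : ℕ) : α (n + 1) * α (n + 2) = p := by
    -- The atom at `0` contributes only to the zeroth moment, so this needs index at least `1`.
    have h : shiftMoment α (n + 3) = shiftMoment α (n + 1) * p ^ 2 := by
      rw [hγ, hγ]; ring
    have h2 := mul_left_cancel₀ (hγpos (n + 1)).ne' ((hstep (n + 1)).trans h)
    exact (sq_eq_sq₀ (mul_pos (hpos _) (hpos _)).le hp.le).1 h2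
  have hα0 : α 0 * α 1 = √(a + c) * p := by
    have h2 := hstep 0
    rw [hγ 2] at h2
    have h3 : (α 0 * α 1) ^ 2 = (√(a + c) * p) ^ 2 := by
      rw [mul_pow _ p, Real.sq_sqrt (by positivity)]
      simp [shiftMoment] at h2 ⊢
      linarith
    exact (sq_eq_sq₀ (mul_pos (hpos _) (hpos _)).le (by positivity)).1 h3
  -- The first weight is `√(α₀ α₁) = √(√(a + c) p)`; `s² = √(a + c) ≤ 1` because the total mass is
  -- `1`.
  refine isSubnormalOperator_of_constant_weights e (s := √√(a + c)) (k := √p) ?_ ?_ fun n => ?_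
  · rw [Real.sq_sqrt (Real.sqrt_nonneg _)]
    exact Real.sqrt_le_one.2 (by linarith)
  · rw [aluthge_weightedShift_apply e hbdd hpos, ← Real.sqrt_mul (hpos 0).le, hα0,
      Real.sqrt_mul (Real.sqrt_nonneg _)]
  · rw [aluthge_weightedShift_apply e hbdd hpos, ← Real.sqrt_mul (hpos _).le, hα]

end NormalExtension

theorem mainTheorem1 {H : Type u} [NormedAddCommGroup H] [InnerProductSpace ℂ H] [CompleteSpace H]
    (e : HilbertBasis ℕ ℂ H) (α : ℕ → ℝ) (hpos : ∀ n, 0 < α n)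
    (hbdd : ∃ C : ℝ, ∀ n, |α n| ≤ C)
    (a b c p q r : ℝ) (ha : 0 < a) (hb : 0 < b) (hc : 0 < c)
    (hp : 0 < p) (hpr : -p < r) (hrq : r < q)
    (hμ : IsRepresentingMeasure
      (ENNReal.ofReal a • Measure.dirac (-p) + ENNReal.ofReal b • Measure.dirac r +
        ENNReal.ofReal c • Measure.dirac q) (shiftMoment α)) :
    IsSubnormalOperator (aluthge (weightedShift e α hbdd)) ↔ r = 0 ∧ p = q := by
  have hγ := hμ.eq_of_three_atoms ha.le hb.le hc.le
  constructor
  · intro hT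
    obtain ⟨h0, h1⟩ := isHankelNonneg_shiftMoment_mul e hbdd hpos hT
    -- Otherwise all atoms would be nonpositive and `γ₁ < 0`.
    have hq : 0 < q := by
      by_contra! hq
      have h : shiftMoment α 1 = a * (-p) + b * r + c * q := by simpa using hγ 1
      have h2 : 0 < shiftMoment α 1 := Finset.prod_pos fun i _ => pow_pos (hpos i) 2
      nlinarith [mul_pos ha hp, mul_pos hb (neg_pos.2 (hrq.trans_le hq)),
        mul_nonneg hc.le (neg_nonneg.2 hq)]
    exact eq_zero_and_eq_of_isHankelNonneg ha hb hc hp hpr hrq hq hγ h0 h1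
  · rintro ⟨rfl, rfl⟩
    exact isSubnormalOperator_aluthge_of_symmetric e hpos hbdd ha hb hc hp hγ
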